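/- For $N \ge 1$ let $\mathscr S_{++}(N)$ be the set of real symmetric positive definite $N\times N$ matrices, regarded as an open submanifold of the vector space of symmetric matrices, and let $\mathscr L_{++}(N)$ be the set of lower triangular $N \times N$ matrices with positive diagonal entries. Every $A\in\mathscr S_{++}(N)$ has a Cholesky factor $L\in\mathscr L_{++}(N)$ with $A=LL^\top$. For $A,B\in\mathscr S_{++}(N)$ with Cholesky factors $L,M$, define the adapted Bures–Wasserstein distance and the Knothe–Rosenblatt distance by $$d_{\mathrm{ABW}}(A,B)^2=\operatorname{Tr}A+\operatorname{Tr}B-2\sum_{t=1}^N|(L^\top M)_{tt}|,\qquad d_{\mathrm{KR}}(A,B)^2=\operatorname{Tr}A+\operatorname{Tr}B-2\operatorname{Tr}(L^\top M).$$ **Proposition ($d_{\mathrm{ABW}}$ is not a Riemannian distance).** 1. $d_{\mathrm{KR}}$ is Euclidean in Cholesky coordinates: the Cholesky map $A\mapsto L$ is a bijection of $\mathscr S_{++}(N)$ onto $\mathscr L_{++}(N)$, and $d_{\mathrm{KR}}(A,B)=\|L-M\|_{\mathrm F}$ for all $A,B$, where $\|L\|_{\mathrm F}=\sqrt{\operatorname{Tr}(L^\top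 L)}$. 2. Locally, $d_{\mathrm{ABW}}$ coincides with $d_{\mathrm{KR}}$: every $A\in\mathscr S_{++}(N)$ has a neighborhood $U$ such that $d_{\mathrm{ABW}}(B,C)=d_{\mathrm{KR}}(B,C)$ for all $B,C\in U$. 3. If $N\ge2$, they differ globally: there are $A,B\in\mathscr S_{++}(N)$ with $d_{\mathrm{ABW}}(A,B)\ne d_{\mathrm{KR}}(A,B)$. 4. If $N\ge2$, $d_{\mathrm{ABW}}$ is not induced by any Riemannian metric on $\mathscr S_{++}(N)$, whether smooth or merely of class $C^n$ for some $n \ge 0$: for no such metric $g$ is $d_{\mathrm{ABW}}(A,B)$, for all $A,B$, the infimum of the $g$-lengths of the $C^1$ paths from $A$ to $B$. -/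

import Mathlib

open Matrix Bundle Topology
open scoped Manifold ContDiff ENNReal Matrix.Norms.Elementwise

/-- The submodule of symmetric matrices. -/
def symSubmodule (N : ℕ) : Submodule ℝ (Matrix (Fin N) (Fin N) ℝ) where
  carrier := {A | A.IsSymm}
  add_mem' hA hB := Matrix.IsSymm.add hA hB
  zero_mem' := Matrix.isSymm_zero
  smul_mem' c _ hA := Matrix.IsSymm.smul hA c

/-- The real vector space of symmetric `N × N` matrices. Its norm (the entrywise sup norm) only
serves to fix the topology and the smooth structure, which do not depend on the choice. -/
def SymMat (N : ℕ) : Type := symSubmodule N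

noncomputable instance (N : ℕ) : NormedAddCommGroup (SymMat N) :=
  inferInstanceAs (NormedAddCommGroup (symSubmodule N))

noncomputable instance (N : ℕ) : NormedSpace ℝ (SymMat N) :=
  inferInstanceAs (NormedSpace ℝ (symSubmodule N))

/-- The matrix underlying an element of `SymMat N`. -/
def SymMat.toMatrix {N : ℕ} (A : SymMat N) : Matrix (Fin N) (Fin N) ℝ := A.1

theorem SymMat.continuous_toMatrix (N : ℕ) : Continuous (SymMat.toMatrix (N := N)) :=
  continuous_subtype_val (p := fun A => A ∈ symSubmodule N)

theorem isOpen_posDef (N : ℕ) :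
    IsOpen {A : SymMat N | A.toMatrix.PosDef} := by
  rw [isOpen_iff_eventually]
  intro A hA
  have hc : Continuous fun p : SymMat N × (Fin N → ℝ) =>
      p.2 ⬝ᵥ (p.1.toMatrix *ᵥ p.2) := by
    have := SymMat.continuous_toMatrix N
    fun_prop
  have h := (isCompact_sphere (0 : Fin N → ℝ) 1).eventually_forall_of_forall_eventually
    (x₀ := A) (P := fun B x => 0 < x ⬝ᵥ (B.toMatrix *ᵥ x)) (by
      intro x hx
      have hx0 : x ≠ 0 := by
        rintro rfl
        simp at hx
      have := hA.dotProduct_mulVec_pos hx0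
      simp only [star_trivial] at this
      exact hc.continuousAt.eventually (lt_mem_nhds this))
  filter_upwards [h] with B hB
  refine Matrix.PosDef.of_dotProduct_mulVec_pos ?_ ?_
  · have h2 : B.toMatrixᵀ = B.toMatrix := B.2
    rwa [Matrix.IsHermitian, conjTranspose_eq_transpose_of_trivial]
  · intro x hx
    have hn : 0 < ‖x‖ := norm_pos_iff.2 hx
    have h1 := hB (‖x‖⁻¹ • x) (by simp [norm_smul, hn.ne'])
    simp only [mulVec_smul, smul_dotProduct, dotProduct_smul, smul_eq_mul] at h1
    rw [star_trivial]
    have hi : 0 < ‖x‖⁻¹ := inv_pos.2 hn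
    exact (mul_pos_iff_of_pos_left hi).1 ((mul_pos_iff_of_pos_left hi).1 h1)

/-- The set of symmetric positive definite `N × N` matrices, as an open subset of `SymMat N`. -/
def posDefOpens (N : ℕ) : TopologicalSpace.Opens (SymMat N) :=
  ⟨{A | A.toMatrix.PosDef}, isOpen_posDef N⟩

/-- The manifold of symmetric positive definite `N × N` matrices. -/
abbrev SPD (N : ℕ) : Type := posDefOpens N

/-- The matrix underlying a point of `SPD N`. -/
def SPD.mat {N : ℕ} (A : SPD N) : Matrix (Fin N) (Fin N) ℝ := A.1.toMatrix

/-- Lower triangular matrices with positive diagonal entries. -/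
def LowerPos (N : ℕ) : Set (Matrix (Fin N) (Fin N) ℝ) :=
  {L | L.IsLowerTriangular ∧ ∀ t, 0 < L t t}

theorem exists_cholesky {N : ℕ} (A : SPD N) : ∃ L ∈ LowerPos N, A.mat = L * Lᵀ := by
  have hS : A.mat.PosDef := A.2
  obtain ⟨K, hK⟩ : ∃ K : Matrix (Fin N) (Fin N) ℝ, K = LDL.lower hS := ⟨_, rfl⟩
  have htri : K.IsLowerTriangular := by
    rw [hK]
    exact blockTriangular_inv_of_blockTriangular fun i j hij => LDL.lowerInv_triangular hS hij
  have hdec : K * LDL.diag hS * Kᵀ = A.mat := by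
    have := LDL.lower_conj_diag hS
    rwa [conjTranspose_eq_transpose_of_trivial, ← hK] at this
  have hdet : K.det * (∏ i, LDL.diagEntries hS i) * K.det ≠ 0 := by
    have h := congrArg Matrix.det hdec
    rw [det_mul, det_mul, det_transpose, LDL.diag, det_diagonal] at h
    rw [h]
    exact hS.det_pos.ne'
  have hKd : ∀ i, K i i ≠ 0 := by
    intro i hi
    apply hdet
    have hz : ∏ j, K j j = 0 := Finset.prod_eq_zero (Finset.mem_univ i) hi
    rw [det_of_isLowerTriangular _ htri, hz, mul_zero]
  have hd : ∀ i, 0 < LDL.diagEntries hS i := by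
    have hp : (LDL.diag hS).PosSemidef := by
      rw [LDL.diag_eq_lowerInv_conj]
      exact hS.posSemidef.mul_mul_conjTranspose_same _
    intro i
    have h0 : 0 ≤ LDL.diagEntries hS i := by
      have := hp.diag_nonneg (i := i)
      simpa [LDL.diag] using this
    refine lt_of_le_of_ne h0 fun h => hdet ?_
    rw [Finset.prod_eq_zero (Finset.mem_univ i) h.symm, mul_zero, zero_mul]
  let c : Fin N → ℝ := fun i => SignType.sign (K i i) * Real.sqrt (LDL.diagEntries hS i)
  have hcc : ∀ i, c i * c i = LDL.diagEntries hS i := by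
    intro i
    have h1 : (SignType.sign (K i i) : ℝ) * SignType.sign (K i i) = 1 := by
      rcases lt_or_gt_of_ne (hKd i) with h | h <;> simp [h]
    calc c i * c i = ((SignType.sign (K i i) : ℝ) * SignType.sign (K i i)) *
          (Real.sqrt (LDL.diagEntries hS i) * Real.sqrt (LDL.diagEntries hS i)) := by ring
      _ = _ := by rw [h1, Real.mul_self_sqrt (hd i).le, one_mul]
  refine ⟨K * diagonal c, ⟨fun i j hij => ?_, fun t => ?_⟩, ?_⟩
  · rw [mul_diagonal, htri hij, zero_mul]
  · rw [mul_diagonal]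
    have h1 : 0 < K t t * SignType.sign (K t t) := by
      rw [mul_comm, sign_mul_self]
      exact abs_pos.2 (hKd t)
    rw [← mul_assoc]
    exact mul_pos h1 (Real.sqrt_pos.2 (hd t))
  · rw [transpose_mul, diagonal_transpose, ← hdec, LDL.diag]
    have : diagonal (LDL.diagEntries hS) = diagonal c * diagonal c := by
      rw [diagonal_mul_diagonal]
      congr 1
      funext i
      exact (hcc i).symm
    rw [this]
    simp only [Matrix.mul_assoc]

/-- The Cholesky factor `L` of `A`: lower triangular, positive diagonal, `A = L Lᵀ`. -/
noncomputable def cholesky {N : ℕ} (A : SPD N) : Matrix (Fin N) (Fin N) ℝ :=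
  (exists_cholesky A).choose

theorem cholesky_spec {N : ℕ} (A : SPD N) :
    cholesky A ∈ LowerPos N ∧ A.mat = cholesky A * (cholesky A)ᵀ :=
  (exists_cholesky A).choose_spec

/-- The Frobenius norm `‖L‖_F = √Tr(Lᵀ L)`. -/
noncomputable def frobNorm {N : ℕ} (L : Matrix (Fin N) (Fin N) ℝ) : ℝ :=
  Real.sqrt (Lᵀ * L).trace

/-- The adapted Bures-Wasserstein distance:
`d² = Tr A + Tr B - 2 ‖diag(Lᵀ M)‖₁`, with `L`, `M` the Cholesky factors of `A`, `B`. -/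
noncomputable def dABW {N : ℕ} (A B : SPD N) : ℝ :=
  Real.sqrt (A.mat.trace + B.mat.trace
    - 2 * ∑ t, |((cholesky A)ᵀ * cholesky B) t t|)

/-- The Knothe-Rosenblatt distance: `d² = Tr A + Tr B - 2 Tr(Lᵀ M)`, with `L`, `M` the
Cholesky factors of `A`, `B`. -/
noncomputable def dKR {N : ℕ} (A B : SPD N) : ℝ :=
  Real.sqrt (A.mat.trace + B.mat.trace - 2 * ((cholesky A)ᵀ * cholesky B).trace)

/-- `d` is the distance induced by a Riemannian metric of class `C^n` on the manifold `M`: the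
distance of two points is the infimum of the lengths of the `C^1` paths that join them. -/
def IsRiemannianDistance {E : Type*} [NormedAddCommGroup E] [NormedSpace ℝ E]
    {H : Type*} [TopologicalSpace H] (I : ModelWithCorners ℝ E H) (n : ℕ∞ω)
    {M : Type*} [TopologicalSpace M] [ChartedSpace H M] [IsManifold I 1 M]
    (d : M → M → ℝ) : Prop :=
  ∃ g : ContMDiffRiemannianMetric I n E (fun x : M => TangentSpace I x),
    letI : RiemannianBundle (fun x : M => TangentSpace I x) := ⟨g.toRiemannianMetric⟩
    ∀ x y : M, Manifold.riemannianEDist I x y = ENNReal.ofReal (d x y)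

/-! The diagonal of `LᵀL` is positive and the Cholesky map is continuous, so near any point the
absolute values in `dABW` do nothing and it agrees with `dKR`. For `2 ≤ N`, distant points can make
a diagonal entry of `LᵀM` negative, and then `dABW < dKR`.

Were `dABW` a Riemannian distance, `dKR` would agree with it locally. Cutting a path into short
pieces and using the triangle inequality, which `dKR` inherits from the Frobenius norm, bounds `dKR`
by every path length, so `dKR ≤ dABW` everywhere: a contradiction. The regularity of the metric
plays no role. -/

theorem LowerPos.isUnit_det {N : ℕ} {L : Matrix (Fin N) (Fin N) ℝ} (hL : L ∈ LowerPos N) :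
    IsUnit L.det := by
  rw [det_of_isLowerTriangular _ hL.1]
  exact (Finset.prod_pos fun t _ => hL.2 t).ne'.isUnit

theorem LowerPos.posDef_mul_transpose {N : ℕ} {L : Matrix (Fin N) (Fin N) ℝ}
    (hL : L ∈ LowerPos N) : (L * Lᵀ).PosDef := by
  have h := PosDef.mul_conjTranspose_self L
    (Matrix.vecMul_injective_iff_isUnit.2 ((Matrix.isUnit_iff_isUnit_det L).2 (isUnit_det hL)))
  rwa [conjTranspose_eq_transpose_of_trivial] at h

/-- Uniqueness of the Cholesky factor. -/
theorem LowerPos.eq_of_mul_transpose_eq {N : ℕ} {L M : Matrix (Fin N) (Fin N) ℝ}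
    (hL : L ∈ LowerPos N) (hM : M ∈ LowerPos N) (h : L * Lᵀ = M * Mᵀ) : L = M := by
  have uM := isUnit_det hM
  let := Matrix.invertibleOfIsUnitDet M uM
  -- `K` is lower triangular and orthogonal, so `Kᵀ = K⁻¹` is lower triangular too. Hence `K` is
  -- diagonal, with positive entries of square 1.
  obtain ⟨K, hK⟩ : ∃ K, K = M⁻¹ * L := ⟨_, rfl⟩
  have hLK : L = M * K := by rw [hK, Matrix.mul_nonsing_inv_cancel_left _ _ uM]
  have hKt : K.IsLowerTriangular := by
    rw [hK]
    exact (blockTriangular_inv_of_blockTriangular hM.1).mul hL.1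
  have hKK : K * Kᵀ = 1 := by
    have uMt : IsUnit Mᵀ.det := by rwa [det_transpose]
    have h1 : M * (K * Kᵀ * Mᵀ) = M * (1 * Mᵀ) := by
      rw [one_mul, ← h, hLK, transpose_mul]
      simp only [Matrix.mul_assoc]
    have h2 := congrArg (M⁻¹ * ·) h1
    simp only [Matrix.nonsing_inv_mul_cancel_left _ _ uM] at h2
    have h3 := congrArg (· * Mᵀ⁻¹) h2
    simpa only [Matrix.mul_nonsing_inv_cancel_right _ _ uMt] using h3
  let : Invertible K := invertibleOfRightInverse K Kᵀ hKK
  have hKt' : Kᵀ.IsLowerTriangular := by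
    rw [← Matrix.inv_eq_right_inv hKK]
    exact blockTriangular_inv_of_blockTriangular hKt
  have hoff : ∀ i j, i ≠ j → K i j = 0 := by
    intro i j hij
    rcases lt_or_gt_of_ne hij with hlt | hlt
    · exact hKt (OrderDual.toDual_lt_toDual.2 hlt)
    · exact hKt' (i := j) (j := i) (OrderDual.toDual_lt_toDual.2 hlt)
  have hdiag : K = diagonal fun i => K i i := by
    ext i j
    rcases eq_or_ne i j with rfl | hij
    · simp
    · rw [hoff i j hij, diagonal_apply_ne _ hij]
  have hpos : ∀ i, 0 < K i i := by
    intro i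
    have h1 := hL.2 i
    rw [hLK, hdiag, mul_diagonal] at h1
    exact (mul_pos_iff_of_pos_left (hM.2 i)).1 h1
  have hone : ∀ i, K i i = 1 := by
    intro i
    have h1 := congrFun (congrFun hKK i) i
    rw [hdiag, diagonal_transpose, diagonal_mul_diagonal, diagonal_apply_eq, one_apply_eq] at h1
    nlinarith [hpos i]
  have hK1 : K = 1 := by
    rw [hdiag]
    simp [hone]
  rw [hLK, hK1, mul_one]

/-- The positive definite matrix with a given Cholesky factor. -/
def LowerPos.toSPD {N : ℕ} (L : Matrix (Fin N) (Fin N) ℝ) (hL : L ∈ LowerPos N) : SPD N :=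
  ⟨⟨L * Lᵀ, Matrix.isSymm_mul_transpose_self L⟩, posDef_mul_transpose hL⟩

theorem cholesky_toSPD {N : ℕ} (L : Matrix (Fin N) (Fin N) ℝ) (hL : L ∈ LowerPos N) :
    cholesky (LowerPos.toSPD L hL) = L :=
  LowerPos.eq_of_mul_transpose_eq (cholesky_spec _).1 hL (cholesky_spec (LowerPos.toSPD L hL)).2.symm

theorem SPD.mat_injective {N : ℕ} : Function.Injective (SPD.mat (N := N)) :=
  fun _ _ h => Subtype.ext (Subtype.ext h)

theorem cholesky_bijOn (N : ℕ) : Set.BijOn (cholesky (N := N)) Set.univ (LowerPos N) := by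
  refine ⟨fun A _ => (cholesky_spec A).1, fun A _ B _ h => SPD.mat_injective ?_,
    fun L hL => ⟨LowerPos.toSPD L hL, trivial, cholesky_toSPD L hL⟩⟩
  rw [(cholesky_spec A).2, (cholesky_spec B).2, h]

/-! ### The Frobenius norm and the triangle inequality -/

theorem frobNorm_eq_norm {N : ℕ} (L : Matrix (Fin N) (Fin N) ℝ) :
    frobNorm L = ‖(WithLp.toLp 2 fun p : Fin N × Fin N => L p.1 p.2 :
      EuclideanSpace ℝ (Fin N × Fin N))‖ := by
  rw [frobNorm, EuclideanSpace.norm_eq]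
  congr 1
  simp only [Matrix.trace, diag_apply, mul_apply, transpose_apply, Real.norm_eq_abs, sq_abs,
    Fintype.sum_prod_type]
  rw [Finset.sum_comm]
  simp only [sq]

theorem frobNorm_add_le {N : ℕ} (L M : Matrix (Fin N) (Fin N) ℝ) :
    frobNorm (L + M) ≤ frobNorm L + frobNorm M := by
  simp only [frobNorm_eq_norm]
  exact norm_add_le (WithLp.toLp 2 fun p : Fin N × Fin N => L p.1 p.2 :
    EuclideanSpace ℝ (Fin N × Fin N)) (WithLp.toLp 2 fun p => M p.1 p.2)

theorem dKR_eq_frobNorm {N : ℕ} (A B : SPD N) :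
    dKR A B = frobNorm (cholesky A - cholesky B) := by
  rw [dKR, frobNorm, (cholesky_spec A).2, (cholesky_spec B).2, transpose_sub, sub_mul, mul_sub,
    mul_sub, trace_sub, trace_sub, trace_sub, trace_mul_comm (cholesky A) (cholesky A)ᵀ,
    trace_mul_comm (cholesky B) (cholesky B)ᵀ,
    ← trace_transpose ((cholesky B)ᵀ * cholesky A), transpose_mul, transpose_transpose]
  congr 1
  ring

theorem dKR_triangle {N : ℕ} (A B C : SPD N) : dKR A C ≤ dKR A B + dKR B C := by
  simp only [dKR_eq_frobNorm]
  rw [← sub_add_sub_cancel (cholesky A) (cholesky B) (cholesky C)]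
  exact frobNorm_add_le _ _

theorem dKR_self {N : ℕ} (A : SPD N) : dKR A A = 0 := by
  simp [dKR_eq_frobNorm, frobNorm]

/-! ### Continuity of the Cholesky map -/

theorem SPD.continuous_mat (N : ℕ) : Continuous (SPD.mat (N := N)) :=
  (SymMat.continuous_toMatrix N).comp continuous_subtype_val

theorem cholesky_sq_le_trace {N : ℕ} (A : SPD N) (i j : Fin N) :
    cholesky A i j ^ 2 ≤ A.mat.trace := by
  rw [(cholesky_spec A).2]
  simp only [Matrix.trace, diag_apply, mul_apply, transpose_apply, ← sq]
  exact (Finset.single_le_sum (f := fun k => cholesky A i k ^ 2) (fun _ _ => sq_nonneg _)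
    (Finset.mem_univ j)).trans (Finset.single_le_sum (f := fun i => ∑ k, cholesky A i k ^ 2)
    (fun _ _ => Finset.sum_nonneg fun _ _ => sq_nonneg _) (Finset.mem_univ i))

/-- Compactness plus uniqueness: the factors stay bounded near `A`, since `Tr A` is the sum of the
squared entries of `L`. A cluster point is lower triangular with nonnegative diagonal and factors
`A`; as `det A ≠ 0` its diagonal is positive, so it is the Cholesky factor. -/
theorem continuous_cholesky (N : ℕ) : Continuous (cholesky (N := N)) := by
  rw [continuous_iff_continuousAt]
  intro A
  have hmat := (SPD.continuous_mat N).tendsto A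
  have htr : Filter.Tendsto (fun B : SPD N => B.mat.trace) (𝓝 A) (𝓝 A.mat.trace) :=
    ((SPD.continuous_mat N).matrix_trace).tendsto A
  refine (isCompact_closedBall (0 : Matrix (Fin N) (Fin N) ℝ)
    √(A.mat.trace + 1)).tendsto_nhds_of_unique_mapClusterPt ?_ ?_
  · filter_upwards [htr.eventually (gt_mem_nhds (lt_add_one _))] with B hB
    rw [mem_closedBall_zero_iff, Matrix.norm_le_iff (Real.sqrt_nonneg _)]
    intro i j
    exact Real.abs_le_sqrt ((cholesky_sq_le_trace B i j).trans hB.le)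
  · intro L _ hL
    obtain ⟨F, hF, hFL⟩ := mapClusterPt_iff_ultrafilter.1 hL
    have hLL : A.mat = L * Lᵀ := by
      refine tendsto_nhds_unique (hmat.mono_left hF) ?_
      have hc : Continuous fun M : Matrix (Fin N) (Fin N) ℝ => M * Mᵀ := by fun_prop
      exact ((hc.tendsto L).comp hFL).congr fun B => (cholesky_spec B).2.symm
    have hent : ∀ i j, Filter.Tendsto (fun B => cholesky B i j) F (𝓝 (L i j)) := fun i j =>
      ((continuous_id.matrix_elem i j).tendsto L).comp hFL
    have htri : L.IsLowerTriangular := fun i j hij =>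
      tendsto_nhds_unique (hent i j) (tendsto_const_nhds.congr fun B =>
        ((cholesky_spec B).1.1 hij).symm)
    have hnonneg : ∀ t, 0 ≤ L t t := fun t =>
      ge_of_tendsto' (hent t t) fun B => ((cholesky_spec B).1.2 t).le
    have hdet : L.det ≠ 0 := by
      intro h0
      have hp : A.mat.PosDef := A.2
      have := hp.det_pos
      rw [hLL, det_mul, h0, zero_mul] at this
      exact lt_irrefl _ this
    rw [det_of_isLowerTriangular _ htri] at hdet
    refine LowerPos.eq_of_mul_transpose_eq ⟨htri, fun t => (hnonneg t).lt_of_ne' ?_⟩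
      (cholesky_spec A).1 (hLL ▸ (cholesky_spec A).2)
    exact Finset.prod_ne_zero_iff.1 hdet t (Finset.mem_univ t)

/-! ### Local agreement and global difference -/

theorem exists_mem_nhds_dABW_eq_dKR {N : ℕ} (A : SPD N) :
    ∃ U ∈ 𝓝 A, ∀ B ∈ U, ∀ C ∈ U, dABW B C = dKR B C := by
  have hc : Continuous fun p : SPD N × SPD N => (cholesky p.1)ᵀ * cholesky p.2 :=
    ((continuous_cholesky N).comp continuous_fst).matrix_transpose.matrix_mul
      ((continuous_cholesky N).comp continuous_snd)
  have hpos : ∀ᶠ p : SPD N × SPD N in 𝓝 (A, A), ∀ t, 0 < ((cholesky p.1)ᵀ * cholesky p.2) t t := by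
    rw [Filter.eventually_all]
    intro t
    refine (hc.matrix_elem t t).continuousAt.eventually (lt_mem_nhds ?_)
    have ht := (cholesky_spec A).1.2 t
    simp only [mul_apply, transpose_apply, ← sq]
    exact Finset.sum_pos' (fun _ _ => sq_nonneg _) ⟨t, Finset.mem_univ t, by positivity⟩
  rw [nhds_prod_eq] at hpos
  obtain ⟨U, hU, h⟩ := Filter.eventually_prod_self_iff'.1 hpos
  refine ⟨U, hU, fun B hB C hC => ?_⟩
  simp only [dABW, dKR, Matrix.trace, diag_apply, fun t => abs_of_pos (h B hB C hC t)]

theorem exists_dABW_lt_dKR {N : ℕ} (hN : 2 ≤ N) : ∃ A B : SPD N, dABW A B < dKR A B := by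
  obtain ⟨i, j, hij⟩ : ∃ i j : Fin N, i < j := ⟨⟨0, by omega⟩, ⟨1, by omega⟩, by simp⟩
  have hmem : ∀ c : ℝ, (1 + single j i c : Matrix (Fin N) (Fin N) ℝ) ∈ LowerPos N := by
    refine fun c => ⟨fun a b hab => ?_, fun t => ?_⟩
    · have hab : a < b := OrderDual.toDual_lt_toDual.1 hab
      rw [Matrix.add_apply, one_apply_ne hab.ne, single_apply_of_ne, add_zero]
      rintro ⟨rfl, rfl⟩
      exact hij.not_gt hab
    · rw [Matrix.add_apply, one_apply_eq, single_apply_of_ne]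
      · simp
      · rintro ⟨rfl, rfl⟩
        exact hij.ne rfl
  -- The `(i, i)` entry of `LᵀM` is `1 + 2 * (-2) = -3`.
  refine ⟨LowerPos.toSPD _ (hmem 2), LowerPos.toSPD _ (hmem (-2)), ?_⟩
  have hne : frobNorm ((1 + single j i 2) - (1 + single j i (-2)) : Matrix (Fin N) (Fin N) ℝ) ≠ 0 := by
    rw [frobNorm_eq_norm, norm_ne_zero_iff]
    intro h
    have := congrArg (fun v : EuclideanSpace ℝ (Fin N × Fin N) => v (j, i)) h
    norm_num at this
  -- `Real.sqrt` vanishes on negative numbers, so strict monotonicity needs the larger radicand to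
  -- be positive.
  have hpos : 0 < dKR (LowerPos.toSPD _ (hmem 2)) (LowerPos.toSPD _ (hmem (-2))) := by
    refine lt_of_le_of_ne (Real.sqrt_nonneg _) ?_
    rw [dKR_eq_frobNorm, cholesky_toSPD, cholesky_toSPD]
    exact hne.symm
  rw [dKR] at hpos ⊢
  refine Real.sqrt_lt_sqrt_iff_of_pos (Real.sqrt_pos.1 hpos) |>.2 ?_
  have hsum : ((cholesky (LowerPos.toSPD _ (hmem 2)))ᵀ *
      cholesky (LowerPos.toSPD _ (hmem (-2)))).trace < ∑ t,
        |((cholesky (LowerPos.toSPD _ (hmem 2)))ᵀ *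
          cholesky (LowerPos.toSPD _ (hmem (-2)))) t t| := by
    refine Finset.sum_lt_sum (fun t _ => le_abs_self _) ⟨i, Finset.mem_univ i, ?_⟩
    refine lt_of_lt_of_le ?_ (abs_nonneg _)
    rw [diag_apply, cholesky_toSPD, cholesky_toSPD, transpose_add, transpose_one,
      transpose_single, add_mul, mul_add, mul_add, single_mul_single_same]
    norm_num [single_apply, hij.ne, hij.ne']
  linarith

/-! ### From local bounds to path lengths -/

/-- If `d` is locally bounded by a Finsler distance and satisfies the triangle inequality, then
it is bounded by the length of every `C^1` path. -/
theorem ofReal_le_pathELength_of_locally_le {E : Type*} [NormedAddCommGroup E] [NormedSpace ℝ E]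
    {H : Type*} [TopologicalSpace H] {I : ModelWithCorners ℝ E H}
    {M : Type*} [TopologicalSpace M] [ChartedSpace H M]
    [∀ x : M, ENorm (TangentSpace I x)] [∀ x : M, ENormSMulClass ℝ (TangentSpace I x)]
    {d : M → M → ℝ} (hself : ∀ x, d x x = 0) (htri : ∀ x y z, d x z ≤ d x y + d y z)
    (hloc : ∀ x, ∃ U ∈ 𝓝 x, ∀ y ∈ U, ∀ z ∈ U,
      ENNReal.ofReal (d y z) ≤ Manifold.riemannianEDist I y z)
    {γ : ℝ → M} {a b : ℝ} (hab : a ≤ b) (hγ : ContMDiffOn 𝓘(ℝ, ℝ) I 1 γ (Set.Icc a b)) :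
    ENNReal.ofReal (d (γ a) (γ b)) ≤ Manifold.pathELength I γ a b := by
  choose U hU hd using hloc
  have hcont : Continuous fun t : Set.Icc a b => γ t := hγ.continuousOn.domRestrict
  -- Lebesgue subdivision: each piece of the path lies in a single `U x`, and `t` equals `b` from
  -- index `m` on.
  obtain ⟨t, ht0, htm, ⟨m, hm⟩, hsub⟩ := exists_monotone_Icc_subset_open_cover_Icc hab
    (c := fun x => (fun t : Set.Icc a b => γ t) ⁻¹' interior (U x))
    (fun x => isOpen_interior.preimage hcont)
    (fun s _ => Set.mem_iUnion.2 ⟨γ s, mem_interior_iff_mem_nhds.2 (hU _)⟩)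
  have key : ∀ k, ENNReal.ofReal (d (γ a) (γ (t k))) ≤ Manifold.pathELength I γ a (t k) := by
    intro k
    induction k with
    | zero => simp [ht0, hself]
    | succ k ih =>
      have hle : t k ≤ t (k + 1) := htm k.le_succ
      have hle' : (t k : ℝ) ≤ t (k + 1) := hle
      obtain ⟨x, hx⟩ := hsub k
      have hstep : ENNReal.ofReal (d (γ (t k)) (γ (t (k + 1)))) ≤
          Manifold.pathELength I γ (t k) (t (k + 1)) :=
        (hd x _ (interior_subset (hx (Set.left_mem_Icc.2 hle))) _
          (interior_subset (hx (Set.right_mem_Icc.2 hle)))).trans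
          (Manifold.riemannianEDist_le_pathELength
            (hγ.mono (Set.Icc_subset_Icc (t k).2.1 (t (k + 1)).2.2)) rfl rfl hle')
      calc ENNReal.ofReal (d (γ a) (γ (t (k + 1))))
          ≤ ENNReal.ofReal (d (γ a) (γ (t k)) + d (γ (t k)) (γ (t (k + 1)))) :=
            ENNReal.ofReal_le_ofReal (htri _ _ _)
        _ ≤ _ := ENNReal.ofReal_add_le
        _ ≤ _ := add_le_add ih hstep
        _ = _ := Manifold.pathELength_add (t k).2.1 hle'
  simpa [hm m le_rfl] using key m

theorem ofReal_le_riemannianEDist_of_locally_le {E : Type*} [NormedAddCommGroup E]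
    [NormedSpace ℝ E] {H : Type*} [TopologicalSpace H] {I : ModelWithCorners ℝ E H}
    {M : Type*} [TopologicalSpace M] [ChartedSpace H M]
    [∀ x : M, ENorm (TangentSpace I x)] [∀ x : M, ENormSMulClass ℝ (TangentSpace I x)]
    {d : M → M → ℝ} (hself : ∀ x, d x x = 0) (htri : ∀ x y z, d x z ≤ d x y + d y z)
    (hloc : ∀ x, ∃ U ∈ 𝓝 x, ∀ y ∈ U, ∀ z ∈ U,
      ENNReal.ofReal (d y z) ≤ Manifold.riemannianEDist I y z) (x y : M) :
    ENNReal.ofReal (d x y) ≤ Manifold.riemannianEDist I x y := by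
  refine le_of_forall_gt fun r hr => ?_
  obtain ⟨γ, rfl, rfl, hγ, hlt⟩ := Manifold.exists_lt_of_riemannianEDist_lt hr
  exact (ofReal_le_pathELength_of_locally_le hself htri hloc zero_le_one hγ).trans_lt hlt

theorem not_isRiemannianDistance_dABW {N : ℕ} (hN : 2 ≤ N) (n : ℕ∞ω) :
    ¬ IsRiemannianDistance 𝓘(ℝ, SymMat N) n (dABW (N := N)) := by
  rintro ⟨g, hg⟩
  let : RiemannianBundle (fun x : SPD N => TangentSpace 𝓘(ℝ, SymMat N) x) :=
    ⟨g.toRiemannianMetric⟩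
  obtain ⟨A, B, hlt⟩ := exists_dABW_lt_dKR hN
  have h := ofReal_le_riemannianEDist_of_locally_le (I := 𝓘(ℝ, SymMat N)) dKR_self dKR_triangle
    (fun C => by
      obtain ⟨U, hU, h⟩ := exists_mem_nhds_dABW_eq_dKR C
      exact ⟨U, hU, fun D hD D' hD' => by rw [hg, h D hD D' hD']⟩) A B
  rw [hg] at h
  exact hlt.not_ge ((ENNReal.ofReal_le_ofReal_iff (Real.sqrt_nonneg _)).1 h)

theorem mainTheorem8 (N : ℕ) :
    -- the Cholesky map is an isometry of `(SPD N, dKR)` onto `(LowerPos N, Frobenius)`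
    (Set.BijOn (cholesky (N := N)) Set.univ (LowerPos N) ∧
      ∀ A B : SPD N, dKR A B = frobNorm (cholesky A - cholesky B)) ∧
    -- locally, the two distances coincide
    (∀ A : SPD N, ∃ U ∈ 𝓝 A, ∀ B ∈ U, ∀ C ∈ U, dABW B C = dKR B C) ∧
    -- globally, they differ
    (2 ≤ N → ∃ A B : SPD N, dABW A B ≠ dKR A B) ∧
    -- `dABW` is not induced by a Riemannian metric: smooth (`n = ∞`) or merely `C^n`, `n ≥ 0`
    (2 ≤ N → ∀ n : ℕ∞ω,
      ¬ IsRiemannianDistance 𝓘(ℝ, SymMat N) n (dABW (N := N))) := by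
  refine ⟨⟨cholesky_bijOn N, dKR_eq_frobNorm⟩, exists_mem_nhds_dABW_eq_dKR, fun hN => ?_,
    not_isRiemannianDistance_dABW⟩
  obtain ⟨A, B, h⟩ := exists_dABW_lt_dKR hN
  exact ⟨A, B, h.ne⟩
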